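/- **Setting.** Let $\mathcal A$ be an algebra of subsets of a set $\Omega$, $m$ a finitely additive probability on $\mathcal A$, $X$ a real Banach space with dual $X^*$, and $f:\Omega\to X$. Let $m^*(E)=\inf\{m(A):A\in\mathcal A,\ E\subset A\}$. For $g:\Omega\to\mathbb R$ write $g\in L^1(m)$ if there are $\mathcal A$-simple functions $g_n$ such that $\lim_n m^*(|g_n-g|>c)=0$ for every $c>0$ and $\lim_{n,k}\int|g_n-g_k|\,dm=0$; then $\int g\,dm=\lim_n\int g_n\,dm$, and $\int_A g\,dm=\int 1_Ag\,dm$ for $A\in\mathcal A$. The function $f$ is *weakly integrable* if $x^*f\in L^1(m)$ for all $x^*\in X^*$, *norm integrable* if $\|f\|\in L^1(m)$, and *Pettis integrable* if for each $A\in\mathcal A$ there is $x_A\in X$ with $x^*x_A=\int_Ax^*f\,dm$ for all $x^*\in X^*$. Let $\mathcal A(m)$ be the completion of $\mathcal A$, i.e. the algebra of all $E\subset\Omega$ such that for each $\varepsilon>0$ there are $A,B\in\mathcal A$ with $A\subset E\subset B$ and $m(B\setminus A)<\varepsilon$. A function $g$ is *$m$-null on $A$* if $m^*(A\cap\{|g|>c\})=0$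 for all $c>0$. Let $\Lambda(m,f)$ be the space of all $H:\Omega\times X\to\mathbb R$ such that $H(f):=H(\cdot,f(\cdot))\in L^1(m)$, seminormed by $\int|H(f)|\,dm$, and let $\Lambda_b(m,f)$ be the set of its bounded elements. Functions on $X$, in particular elements of $X^*$, are viewed as functions on $\Omega\times X$. An *abstract standard representation* of $(m,f)$ is a triple $(\chi,\lambda,T)$ where $\lambda$ is a regular countably additive probability on the Borel sets $\mathcal B(S)$ of a compact Hausdorff space $S$, $\chi$ is a Boolean homomorphism of $\mathcal A(m)$ into the clopen subsets of $S$, and $T:\Lambda(m,f)\to L^1(\lambda)$ is an isometric vector lattice homomorphism such that $$\int_AH(f)\,dm=\int_{\chi(A)}T(H)\,d\lambda\qquad(A\in\mathcal A,\ H\in\Lambda(m,f)),$$ and such that moreover: * (a) $T$ is an algebraic isomorphism of $\Lambda_b(m,f)$ onto $C(S)$, i.e. there is an algebra isomorphism $U:\Lambda_b(m,f)\to C(S)$ such that $T(H)$ is the $\lambda$-class of $U(H)$ for all $H\in\Lambda_b(m,f)$; * (b) every $g\in C(S)$ is measurable for the $\sigma$-algebra generated by the clopen subsets of $S$; * (c)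 for every clopen $E\subset S$ there is $A\in\mathcal A(m)$ with $\lambda(E\bigtriangleup\chi(A))=0$; * (d) $T[\Lambda(m,f)]$ is norm dense in $L^1(\lambda)$; * (e) $\alpha(T(H_1),\dots,T(H_n))=T(\alpha(H_1,\dots,H_n))$ $\lambda$-a.s. for all $n$, all $H_1,\dots,H_n\in\Lambda(m,f)$ and all bounded continuous $\alpha:\mathbb R^n\to\mathbb R$; * (f) for $A\in\mathcal A(m)$ and $h\in\Lambda(m,f)$, $h(f)$ is $m$-null on $A$ if and only if $T(h)=0$ $\lambda$-a.s. on $\chi(A)$; moreover the union of the sets $\chi(A)\cap\{U(h)\ne0\}$, over all $h\in\Lambda_b(m,f)$ with $h(f)$ $m$-null on $A$, is $\lambda$-null. If $f$ is weakly and norm integrable, then $X^*\subset\Lambda(m,f)$ and the restriction $T_0:X^*\to L^1(\lambda)$ of $T$ to $X^*$ is a bounded linear operator. Let $T_0^*:L^\infty(\lambda)\to X^{**}$, $T_0^*(b)x^*=\int b\,T_0(x^*)\,d\lambda$, be its adjoint. The *standard vector measure* is the $X^{**}$-valued, countably additive set function $\widetilde F(E)=T_0^*(1_E)$ on $\mathcal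 B(S)$; it satisfies $\widetilde F(\chi(A))x^*=\int_Ax^*f\,dm$ for $A\in\mathcal A$. The *bounded weak\* topology* of $X^*$ is the topology in which a set $V$ is open if and only if, for each $r$, $V\cap\{\|x^*\|\le r\}$ is relatively weak\* open in $\{\|x^*\|\le r\}$. **Lemma.** Let $f$ be weakly and norm integrable and let $(\chi,\lambda,T)$ be an abstract standard representation of $(m,f)$, with $T_0$ and $\widetilde F$ as above. Then the following are equivalent: * $f$ is Pettis integrable; * (i) the range of $T_0^*$ is contained in the canonical image of $X$ in $X^{**}$; * (ii) $\widetilde F$ takes its values in the canonical image of $X$ in $X^{**}$; * (iii) $T_0$ is continuous from the weak\* topology of $X^*$ to the weak topology of $L^1(\lambda)$; * (iv) $T_0$ is continuous from the bounded weak\* topology of $X^*$ to the weak topology of $L^1(\lambda)$. -/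

import Mathlib

open MeasureTheory Filter Topology Set
open scoped NNReal ENNReal

/-! ### Integration with respect to a finitely additive measure -/

section FinitelyAdditive

variable {Ω : Type*} {𝒜 : Set (Set Ω)}

/-- The outer measure `m*(E) = inf {m A : A ∈ 𝒜, E ⊆ A}`. -/
noncomputable def outerContent (m : AddContent ℝ≥0 𝒜) (E : Set Ω) : ℝ≥0 :=
  sInf {r | ∃ A ∈ 𝒜, E ⊆ A ∧ m A = r}

/-- `φ` is an `𝒜`-simple function. -/
def IsFASimple (𝒜 : Set (Set Ω)) (φ : Ω → ℝ) : Prop :=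
  (range φ).Finite ∧ ∀ y, φ ⁻¹' {y} ∈ 𝒜

/-- The integral `∑ y, y * m (φ = y)` of an `𝒜`-simple function. -/
noncomputable def simpleIntegral (m : AddContent ℝ≥0 𝒜) (φ : Ω → ℝ) : ℝ :=
  ∑ᶠ y : ℝ, y * (m (φ ⁻¹' {y}) : ℝ)

/-- `φ n` converges to `g` in `m`-measure. -/
def ConvergesInContent (m : AddContent ℝ≥0 𝒜) (φ : ℕ → Ω → ℝ) (g : Ω → ℝ) : Prop :=
  ∀ c : ℝ, 0 < c → Tendsto (fun n => outerContent m {ω | c < |φ n ω - g ω|}) atTop (𝓝 0)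

/-- `φ` is a sequence of `𝒜`-simple functions which converges to `g` in `m`-measure and
satisfies `∫ |φ p - φ q| dm → 0` as `p, q → ∞`. -/
structure IsDeterminingSequence (m : AddContent ℝ≥0 𝒜) (φ : ℕ → Ω → ℝ) (g : Ω → ℝ) : Prop where
  simple : ∀ n, IsFASimple 𝒜 (φ n)
  converges : ConvergesInContent m φ g
  cauchy : Tendsto (fun p : ℕ × ℕ => simpleIntegral m (fun ω => |φ p.1 ω - φ p.2 ω|))
    atTop (𝓝 0)

/-- `g ∈ L¹(m)`. -/
def FAIntegrable (m : AddContent ℝ≥0 𝒜) (g : Ω → ℝ) : Prop :=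
  ∃ φ : ℕ → Ω → ℝ, IsDeterminingSequence m φ g

/-- `g ∈ L¹(m)` and `∫ g dm = I`. -/
def HasFAIntegral (m : AddContent ℝ≥0 𝒜) (g : Ω → ℝ) (I : ℝ) : Prop :=
  ∃ φ : ℕ → Ω → ℝ, IsDeterminingSequence m φ g ∧
    Tendsto (fun n => simpleIntegral m (φ n)) atTop (𝓝 I)

/-- The completion `𝒜(m)`: the sets which can be approximated in `m` from inside and from
outside by sets of `𝒜`. -/
def contentCompletion (m : AddContent ℝ≥0 𝒜) : Set (Set Ω) :=
  {E | ∀ ε : ℝ≥0, 0 < ε → ∃ A ∈ 𝒜, ∃ B ∈ 𝒜, A ⊆ E ∧ E ⊆ B ∧ m (B \ A) < ε}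

/-- `g` is `m`-null on `A`. -/
def FANullOn (m : AddContent ℝ≥0 𝒜) (A : Set Ω) (g : Ω → ℝ) : Prop :=
  ∀ c : ℝ, 0 < c → outerContent m {ω | ω ∈ A ∧ c < |g ω|} = 0

end FinitelyAdditive

/-! ### Vector valued functions and abstract standard representations -/

section Representation

set_option linter.unusedSectionVars false

variable {Ω : Type*} {𝒜 : Set (Set Ω)} {X : Type*} [NormedAddCommGroup X] [NormedSpace ℝ X]

/-- `f` is weakly integrable: `x* ∘ f ∈ L¹(m)` for all `x* ∈ X*`. -/
def WeaklyIntegrable (m : AddContent ℝ≥0 𝒜) (f : Ω → X) : Prop :=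
  ∀ x' : StrongDual ℝ X, FAIntegrable m (fun ω => x' (f ω))

/-- `f` is norm integrable: `‖f‖ ∈ L¹(m)`. -/
def NormIntegrable (m : AddContent ℝ≥0 𝒜) (f : Ω → X) : Prop :=
  FAIntegrable m (fun ω => ‖f ω‖)

/-- `f` is Pettis integrable: for every `A ∈ 𝒜` there is `x ∈ X` with
`x* x = ∫_A x* f dm` for all `x* ∈ X*`. -/
def PettisIntegrable (m : AddContent ℝ≥0 𝒜) (f : Ω → X) : Prop :=
  ∀ A ∈ 𝒜, ∃ x : X, ∀ x' : StrongDual ℝ X,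
    HasFAIntegral m (A.indicator fun ω => x' (f ω)) (x' x)

/-- The space `Λ(m, f)` of the functions `H : Ω × X → ℝ` with `H(·, f(·)) ∈ L¹(m)`. -/
def LambdaSpace (m : AddContent ℝ≥0 𝒜) (f : Ω → X) : Set (Ω × X → ℝ) :=
  {H | FAIntegrable m (fun ω => H (ω, f ω))}

variable {S : Type*} [TopologicalSpace S] [MeasurableSpace S]

/-- An abstract standard representation `(χ, μ, T)` of `(m, f)`. Only the values of `χ` on the
completion of `𝒜` and those of `T` on `Λ(m, f)` matter. The field `lift` is the inverse of the
isomorphism induced by `T` from the bounded elements of `Λ(m, f)` onto `C(S)`. -/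
structure AbstractStandardRepresentation (m : AddContent ℝ≥0 𝒜) (f : Ω → X) (μ : Measure S) where
  /-- the Boolean homomorphism of the completion of `𝒜` into the clopen subsets of `S` -/
  χ : Set Ω → Set S
  isClopen_χ : ∀ A ∈ contentCompletion m, IsClopen (χ A)
  χ_univ : χ univ = univ
  χ_compl : ∀ A ∈ contentCompletion m, χ Aᶜ = (χ A)ᶜ
  χ_union : ∀ A ∈ contentCompletion m, ∀ B ∈ contentCompletion m, χ (A ∪ B) = χ A ∪ χ B
  /-- the isometric vector lattice homomorphism of `Λ(m, f)` into `L¹(μ)` -/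
  T : (Ω × X → ℝ) → Lp ℝ 1 μ
  T_add : ∀ H ∈ LambdaSpace m f, ∀ G ∈ LambdaSpace m f, T (H + G) = T H + T G
  T_smul : ∀ c : ℝ, ∀ H ∈ LambdaSpace m f, T (c • H) = c • T H
  T_sup : ∀ H ∈ LambdaSpace m f, ∀ G ∈ LambdaSpace m f, T (H ⊔ G) = T H ⊔ T G
  T_inf : ∀ H ∈ LambdaSpace m f, ∀ G ∈ LambdaSpace m f, T (H ⊓ G) = T H ⊓ T G
  T_isometric : ∀ H ∈ LambdaSpace m f, HasFAIntegral m (fun ω => |H (ω, f ω)|) ‖T H‖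
  /-- `∫_A H(f) dm = ∫_{χ(A)} T(H) dμ` -/
  integral_eq : ∀ A ∈ 𝒜, ∀ H ∈ LambdaSpace m f,
    HasFAIntegral m (A.indicator fun ω => H (ω, f ω)) (∫ s in χ A, T H s ∂μ)
  /-- `T` is an algebraic isomorphism of the bounded elements of `Λ(m, f)` onto `C(S)`. -/
  lift : C(S, ℝ) →ₐ[ℝ] (Ω × X → ℝ)
  lift_injective : Function.Injective lift
  range_lift : range lift = {H | H ∈ LambdaSpace m f ∧ ∃ C : ℝ, ∀ p, |H p| ≤ C}
  T_lift : ∀ g : C(S, ℝ), T (lift g) =ᵐ[μ] g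
  /-- Continuous functions on `S` are measurable for the σ-algebra generated by clopen sets. -/
  measurable_continuous : ∀ g : C(S, ℝ),
    Measurable[MeasurableSpace.generateFrom {E : Set S | IsClopen E}] g
  clopen_approx : ∀ E : Set S, IsClopen E → ∃ A ∈ contentCompletion m, μ (symmDiff E (χ A)) = 0
  dense_range : Dense (T '' LambdaSpace m f)
  T_comp : ∀ (n : ℕ) (H : Fin n → Ω × X → ℝ) (α : BoundedContinuousFunction (Fin n → ℝ) ℝ),
    (∀ i, H i ∈ LambdaSpace m f) →
      T (fun p => α fun i => H i p) =ᵐ[μ] fun s => α fun i => T (H i) s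
  null_iff : ∀ A ∈ contentCompletion m, ∀ h ∈ LambdaSpace m f,
    FANullOn m A (fun ω => h (ω, f ω)) ↔ ∀ᵐ s ∂μ, s ∈ χ A → T h s = 0
  /-- The union of `χ(A) ∩ {T(h) ≠ 0}` over all bounded `h ∈ Λ(m, f)` with `h(f)` `m`-null
  on `A` (where `T(h)` is the continuous version) is `μ`-null. -/
  null_union : ∀ A ∈ contentCompletion m,
    μ {s | s ∈ χ A ∧ ∃ g : C(S, ℝ), FANullOn m A (fun ω => lift g (ω, f ω)) ∧ g s ≠ 0} = 0

namespace AbstractStandardRepresentation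

variable {m : AddContent ℝ≥0 𝒜} {f : Ω → X} {μ : Measure S}

/-- `x* ∈ X*` seen as an element of `Λ(m, f)`. -/
def ofDual (Ω : Type*) {X : Type*} [NormedAddCommGroup X] [NormedSpace ℝ X]
    (x' : StrongDual ℝ X) : Ω × X → ℝ := fun p => x' p.2

/-- The norm of `X` seen as an element of `Λ(m, f)`. -/
def ofNorm (Ω X : Type*) [NormedAddCommGroup X] : Ω × X → ℝ := fun p => ‖p.2‖

theorem T_mono (R : AbstractStandardRepresentation m f μ) {H G : Ω × X → ℝ}
    (hH : H ∈ LambdaSpace m f) (hG : G ∈ LambdaSpace m f) (h : H ≤ G) : R.T H ≤ R.T G := by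
  have h1 := R.T_sup H hH G hG
  rw [sup_eq_right.mpr h] at h1
  rw [h1]
  exact le_sup_left

theorem abs_T_le (R : AbstractStandardRepresentation m f μ) (hw : WeaklyIntegrable m f)
    (hn : NormIntegrable m f) (x' : StrongDual ℝ X) :
    |R.T (ofDual Ω x')| ≤ ‖x'‖ • R.T (ofNorm Ω X) := by
  have key : ∀ y : StrongDual ℝ X, ‖y‖ ≤ 1 → R.T (ofDual Ω y) ≤ R.T (ofNorm Ω X) := by
    intro y hy
    refine R.T_mono (hw y) hn fun p => ?_
    calc y p.2 ≤ ‖y p.2‖ := le_abs_self _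
      _ ≤ ‖y‖ * ‖p.2‖ := y.le_opNorm _
      _ ≤ 1 * ‖p.2‖ := by gcongr
      _ = ‖p.2‖ := one_mul _
  have key2 : ∀ y : StrongDual ℝ X, R.T (ofDual Ω y) ≤ ‖y‖ • R.T (ofNorm Ω X) := by
    intro y
    rcases eq_or_ne y 0 with rfl | hy
    · have h0 := R.T_smul 0 (ofDual Ω (0 : StrongDual ℝ X)) (hw 0)
      have h1 : (0 : ℝ) • ofDual Ω (0 : StrongDual ℝ X) = ofDual Ω 0 := by
        ext p; simp [ofDual]
      rw [h1] at h0
      rw [h0]; simp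
    · have hy' : ‖y‖ ≠ 0 := norm_ne_zero_iff.mpr hy
      have h1 : ofDual Ω y = ‖y‖ • ofDual Ω (‖y‖⁻¹ • y) := by
        ext p; simp [ofDual, hy']
      rw [h1, R.T_smul _ _ (hw _)]
      have h2 := key (‖y‖⁻¹ • y) (by rw [norm_smul, norm_inv, norm_norm, inv_mul_cancel₀ hy'])
      rw [← Lp.coeFn_le] at h2 ⊢
      filter_upwards [h2, Lp.coeFn_smul ‖y‖ (R.T (ofDual Ω (‖y‖⁻¹ • y))),
        Lp.coeFn_smul ‖y‖ (R.T (ofNorm Ω X))] with s h3 h4 h5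
      rw [h4, h5]
      exact mul_le_mul_of_nonneg_left h3 (norm_nonneg y)
  refine abs_le'.mpr ⟨key2 x', ?_⟩
  have h1 : ofDual Ω (-x') = (-1 : ℝ) • ofDual Ω x' := by
    ext p; simp [ofDual]
  have h2 := key2 (-x')
  rw [h1, R.T_smul _ _ (hw _), norm_neg, neg_one_smul] at h2
  exact h2

/-- The restriction `T₀ : X* → L¹(μ)` of `T` to `X*`. -/
noncomputable def T₀ (R : AbstractStandardRepresentation m f μ) (hw : WeaklyIntegrable m f)
    (hn : NormIntegrable m f) : StrongDual ℝ X →L[ℝ] Lp ℝ 1 μ :=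
  LinearMap.mkContinuous
    { toFun := fun x' => R.T (ofDual Ω x')
      map_add' := fun x' y' => R.T_add _ (hw x') _ (hw y')
      map_smul' := fun c x' => R.T_smul c _ (hw x') }
    ‖R.T (ofNorm Ω X)‖
    (fun x' => by
      have h1 : |R.T (ofDual Ω x')| ≤ |‖x'‖ • R.T (ofNorm Ω X)| :=
        (R.abs_T_le hw hn x').trans (le_abs_self _)
      have h2 := norm_le_norm_of_abs_le_abs h1
      rw [norm_smul, norm_norm, mul_comm] at h2
      exact h2)

/-- The adjoint `T₀* : L^∞(μ) → X**`, that is `T₀*(b) x* = ∫ b T₀(x*) dμ`. -/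
noncomputable def T₀adj (R : AbstractStandardRepresentation m f μ) (hw : WeaklyIntegrable m f)
    (hn : NormIntegrable m f) : Lp ℝ ∞ μ →L[ℝ] StrongDual ℝ (StrongDual ℝ X) :=
  ((ContinuousLinearMap.compL ℝ (StrongDual ℝ X) (Lp ℝ 1 μ) ℝ).flip (R.T₀ hw hn)).comp
    ((ContinuousLinearMap.mul ℝ ℝ).lpPairing μ ∞ 1)

theorem T₀adj_apply (R : AbstractStandardRepresentation m f μ) (hw : WeaklyIntegrable m f)
    (hn : NormIntegrable m f) (b : Lp ℝ ∞ μ) (x' : StrongDual ℝ X) :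
    R.T₀adj hw hn b x' = ∫ s, b s * R.T₀ hw hn x' s ∂μ := by
  simp [T₀adj, ContinuousLinearMap.lpPairing_eq_integral]

theorem T₀adj_indicator (R : AbstractStandardRepresentation m f μ) [IsFiniteMeasure μ]
    (hw : WeaklyIntegrable m f) (hn : NormIntegrable m f) {E : Set S} (hE : MeasurableSet E)
    (x' : StrongDual ℝ X) :
    R.T₀adj hw hn (indicatorConstLp ∞ hE (measure_ne_top μ E) 1) x'
      = ∫ s in E, R.T₀ hw hn x' s ∂μ := by
  rw [T₀adj_apply, ← integral_indicator hE]
  refine integral_congr_ae ?_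
  filter_upwards [indicatorConstLp_coeFn (p := ∞) (hs := hE) (hμs := measure_ne_top μ E)
    (c := (1 : ℝ))] with s hs
  rw [hs]
  by_cases h : s ∈ E <;> simp [h]

theorem norm_T₀adj_indicator_le (R : AbstractStandardRepresentation m f μ) [IsFiniteMeasure μ]
    (hw : WeaklyIntegrable m f) (hn : NormIntegrable m f) {E : Set S} (hE : MeasurableSet E) :
    ‖R.T₀adj hw hn (indicatorConstLp ∞ hE (measure_ne_top μ E) 1)‖
      ≤ ∫ s in E, |R.T (ofNorm Ω X) s| ∂μ := by
  refine ContinuousLinearMap.opNorm_le_bound _ (integral_nonneg fun _ => abs_nonneg _) fun x' => ?_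
  rw [T₀adj_indicator, mul_comm, ← integral_const_mul]
  have hi : Integrable (R.T (ofNorm Ω X)) μ := L1.integrable_coeFn _
  refine norm_integral_le_of_norm_le (hi.abs.const_mul _).integrableOn (ae_restrict_of_ae ?_)
  have h1 := R.abs_T_le hw hn x'
  rw [← Lp.coeFn_le] at h1
  filter_upwards [h1, Lp.coeFn_abs (R.T (ofDual Ω x')),
    Lp.coeFn_smul ‖x'‖ (R.T (ofNorm Ω X))] with s h2 h3 h4
  rw [h3, h4] at h2
  exact h2.trans (mul_le_mul_of_nonneg_left (le_abs_self _) (norm_nonneg _))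

theorem hasSum_of_norm_sub_le {E : Type*} [NormedAddCommGroup E] {u : ℕ → E} {a : E}
    {b : Finset ℕ → ℝ} (h : ∀ s, ‖a - ∑ i ∈ s, u i‖ ≤ b s) (hb : Tendsto b atTop (𝓝 0)) :
    HasSum u a := by
  rw [HasSum, SummationFilter.unconditional_filter, tendsto_iff_norm_sub_tendsto_zero]
  exact squeeze_zero (fun s => norm_nonneg _) (fun s => by rw [norm_sub_rev]; exact h s) hb

theorem hasSum_T₀adj_indicator (R : AbstractStandardRepresentation m f μ) [IsFiniteMeasure μ]
    (hw : WeaklyIntegrable m f) (hn : NormIntegrable m f) {E : ℕ → Set S}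
    (hE : ∀ i, MeasurableSet (E i)) (hd : Pairwise (Function.onFun Disjoint E)) :
    HasSum (fun i => R.T₀adj hw hn (indicatorConstLp ∞ (hE i) (measure_ne_top μ (E i)) 1))
      (R.T₀adj hw hn (indicatorConstLp ∞ (MeasurableSet.iUnion hE) (measure_ne_top μ _) 1)) := by
  classical
  have hi : Integrable (R.T (ofNorm Ω X)) μ := L1.integrable_coeFn _
  have hU : MeasurableSet (⋃ i, E i) := MeasurableSet.iUnion hE
  have hdec : ∀ (h : S → ℝ), Integrable h μ → ∀ s : Finset ℕ,
      (∫ x in ⋃ i, E i, h x ∂μ) - ∑ i ∈ s, ∫ x in E i, h x ∂μ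
        = ∫ x in (⋃ i, E i) \ ⋃ i ∈ s, E i, h x ∂μ := by
    intro h hh s
    rw [setIntegral_sdiff (s.measurableSet_biUnion fun i _ => hE i) hh.integrableOn
      (iUnion₂_subset fun i _ => subset_iUnion E i),
      integral_biUnion_finset s (fun i _ => hE i) (fun i _ j _ hij => hd hij)
      (fun i _ => hh.integrableOn)]
  have hlim : Tendsto (fun s : Finset ℕ => (∫ x in ⋃ i, E i, |R.T (ofNorm Ω X) x| ∂μ)
      - ∑ i ∈ s, ∫ x in E i, |R.T (ofNorm Ω X) x| ∂μ) atTop (𝓝 0) := by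
    have h1 : HasSum (fun i => ∫ x in E i, |R.T (ofNorm Ω X) x| ∂μ)
        (∫ x in ⋃ i, E i, |R.T (ofNorm Ω X) x| ∂μ) :=
      hasSum_integral_iUnion hE hd hi.abs.integrableOn
    have h2 := (tendsto_const_nhds (x := ∫ x in ⋃ i, E i, |R.T (ofNorm Ω X) x| ∂μ)).sub h1
    rwa [sub_self] at h2
  refine hasSum_of_norm_sub_le (E := StrongDual ℝ (StrongDual ℝ X)) (fun s => ?_) hlim
  have hD : MeasurableSet ((⋃ i, E i) \ ⋃ i ∈ s, E i) :=
    hU.diff (s.measurableSet_biUnion fun i _ => hE i)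
  have hsum : R.T₀adj hw hn (indicatorConstLp ∞ hU (measure_ne_top μ _) 1)
      - ∑ i ∈ s, R.T₀adj hw hn (indicatorConstLp ∞ (hE i) (measure_ne_top μ (E i)) 1)
      = R.T₀adj hw hn (indicatorConstLp ∞ hD (measure_ne_top μ _) 1) := by
    ext x'
    simp only [sub_apply, sum_apply, T₀adj_indicator]
    exact hdec _ (L1.integrable_coeFn _) s
  rw [hsum, hdec _ hi.abs s]
  exact R.norm_T₀adj_indicator_le hw hn hD

open Classical in
/-- The standard vector measure `F̃(E) = T₀*(1_E)` on the measurable subsets of `S`, with values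
in `X**`. -/
noncomputable def stdVectorMeasure (R : AbstractStandardRepresentation m f μ) [IsFiniteMeasure μ]
    (hw : WeaklyIntegrable m f) (hn : NormIntegrable m f) :
    VectorMeasure S (StrongDual ℝ (StrongDual ℝ X)) where
  measureOf' E := if hE : MeasurableSet E then
    R.T₀adj hw hn (indicatorConstLp ∞ hE (measure_ne_top μ E) 1) else 0
  empty' := by
    simp
  not_measurable' E hE := by simp [hE]
  m_iUnion' E hE hd := by
    simp only [hE, MeasurableSet.iUnion hE, dif_pos]
    exact R.hasSum_T₀adj_indicator hw hn hE hd

theorem stdVectorMeasure_apply (R : AbstractStandardRepresentation m f μ) [IsFiniteMeasure μ]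
    (hw : WeaklyIntegrable m f) (hn : NormIntegrable m f) {E : Set S} (hE : MeasurableSet E) :
    R.stdVectorMeasure hw hn E
      = R.T₀adj hw hn (indicatorConstLp ∞ hE (measure_ne_top μ E) 1) :=
  dif_pos hE

/-- `F̃(χ(A)) x* = ∫_A x* f dm`. -/
theorem stdVectorMeasure_χ (R : AbstractStandardRepresentation m f μ) [IsFiniteMeasure μ]
    [OpensMeasurableSpace S] (hw : WeaklyIntegrable m f) (hn : NormIntegrable m f)
    {A : Set Ω} (hA : A ∈ 𝒜) (x' : StrongDual ℝ X) :
    HasFAIntegral m (A.indicator fun ω => x' (f ω)) (R.stdVectorMeasure hw hn (R.χ A) x') := by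
  have hA' : A ∈ contentCompletion m := fun ε hε =>
    ⟨A, hA, A, hA, subset_rfl, subset_rfl, by simpa using hε⟩
  rw [stdVectorMeasure_apply _ _ _ (R.isClopen_χ A hA').isOpen.measurableSet, T₀adj_indicator]
  exact R.integral_eq A hA (ofDual Ω x') (hw x')

end AbstractStandardRepresentation

end Representation

/-- The bounded weak* topology of `X*`: a set is open if and only if its intersection with every
closed ball `{‖x*‖ ≤ r}` is relatively weak* open in that ball. -/
noncomputable abbrev boundedWeakStarTopology (X : Type*) [NormedAddCommGroup X] [NormedSpace ℝ X] :
    TopologicalSpace (WeakDual ℝ X) :=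
  ⨆ r : ℝ, TopologicalSpace.coinduced
    (Subtype.val : {x' : WeakDual ℝ X // ‖WeakDual.toStrongDual x'‖ ≤ r} → WeakDual ℝ X)
    inferInstance

/-! ### The finitely additive integral: simple functions, outer content, uniqueness. -/

section FiniteAdditivity

variable {Ω : Type*} {𝒜 : Set (Set Ω)}

/-! Everything rests on one domination. Since `T` is a positive operator, `|T₀ x'| ≤ ‖x'‖ • w` with
`w = T(‖·‖)` in `L¹(μ)`, so `‖T₀*(b)‖ ≤ ∫ |b| |w| dμ`. Thus `T₀*` is controlled by a weighted `L¹`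
seminorm and not only by the sup norm: it turns a.e. convergence of uniformly bounded functions into
norm convergence. As `X` is complete, its image in `X**` is norm closed, and membership in `X`
survives such limits.

Pettis integrability says exactly that `F̃(χ(A))` lies in `X` for `A ∈ 𝒜`, once the finitely
additive integral is known to be unique (`HasFAIntegral.unique`). The sets `χ(A)` are dense in the
measure algebra of `μ` (`measureDense_χ`): Borel sets are approximated by clopen ones through
regularity and Urysohn functions, clopen sets agree a.e. with some `χ(D)`, and `D` in the completion
is squeezed between sets of `𝒜`. The domination carries membership from `χ(A)` to all Borel sets,
then from indicators to simple functions and to all of `L^∞(μ)`.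

The continuity conditions are duality. Every functional on `L¹(μ)` is integration against some `b`
in `L^∞(μ)`, and its composition with `T₀` is `T₀*(b)`; if this is evaluation at a vector, it is
weak* continuous. Conversely, bounded weak* continuity gives weak* continuity of `T₀*(b)` on the
unit ball, and by Hahn–Banach such a functional is a norm limit of evaluations, hence an evaluation.
-/

/-- Finite additivity allows cells on which `c` takes the same value to be merged, so the integral
can be computed on any finite partition, not only the one by level sets. -/
theorem simpleIntegral_comp (h𝒜 : IsSetAlgebra 𝒜) (m : AddContent ℝ≥0 𝒜) {ι : Type*} [Fintype ι]
    {π : Ω → ι} (hπ : ∀ i, π ⁻¹' {i} ∈ 𝒜) (c : ι → ℝ) :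
    simpleIntegral m (fun ω => c (π ω)) = ∑ i, c i * (m (π ⁻¹' {i}) : ℝ) := by
  classical
  have key : ∀ y : ℝ, (m ((fun ω => c (π ω)) ⁻¹' {y}) : ℝ)
      = ∑ i with c i = y, (m (π ⁻¹' {i}) : ℝ) := by
    intro y
    have h1 : (fun ω => c (π ω)) ⁻¹' {y}
        = ⋃ i ∈ Finset.univ.filter (fun i => c i = y), π ⁻¹' {i} := by
      ext ω; simp
    have hd : ((Finset.univ.filter fun i => c i = y : Finset ι) : Set ι).PairwiseDisjoint
        (fun i => π ⁻¹' {i}) := by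
      intro i _ j _ hij
      exact Disjoint.preimage π (by simpa using hij)
    rw [h1, addContent_biUnion_eq h𝒜.isSetRing (fun i _ => hπ i) hd, NNReal.coe_sum]
  rw [simpleIntegral, finsum_eq_sum_of_support_subset (s := Finset.univ.image c)]
  · rw [← Finset.sum_fiberwise_of_maps_to (g := c) (t := Finset.univ.image c)
      (fun i _ => Finset.mem_image_of_mem c (Finset.mem_univ i))]
    refine Finset.sum_congr rfl fun y _ => ?_
    rw [key, Finset.mul_sum]
    refine Finset.sum_congr rfl fun i hi => ?_
    rw [(Finset.mem_filter.mp hi).2]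
  · intro y hy
    by_contra hne
    refine hy ?_
    have : (Finset.univ.filter fun i => c i = y) = ∅ := by
      ext i
      simp only [Finset.mem_filter, Finset.mem_univ, true_and, Finset.notMem_empty, iff_false]
      rintro rfl
      exact hne (by simp)
    simp only [key, this, Finset.sum_empty, mul_zero]

theorem isFASimple_comp (h𝒜 : IsSetAlgebra 𝒜) {ι : Type*} [Finite ι]
    {π : Ω → ι} (hπ : ∀ i, π ⁻¹' {i} ∈ 𝒜) (c : ι → ℝ) : IsFASimple 𝒜 (fun ω => c (π ω)) := by
  classical
  have := Fintype.ofFinite ι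
  refine ⟨(finite_range c).subset (by rintro _ ⟨ω, rfl⟩; exact ⟨π ω, rfl⟩), fun y => ?_⟩
  have h1 : (fun ω => c (π ω)) ⁻¹' {y}
      = ⋃ i ∈ Finset.univ.filter (fun i => c i = y), π ⁻¹' {i} := by
    ext ω; simp
  rw [h1]
  exact h𝒜.biUnion_mem _ fun i _ => hπ i

/-- The cells are the intersections of level sets, indexed by pairs of values. Linearity and
monotonicity of the integral then reduce to finite sums. -/
theorem IsFASimple.exists_common_partition (h𝒜 : IsSetAlgebra 𝒜) {φ ψ : Ω → ℝ}
    (hφ : IsFASimple 𝒜 φ) (hψ : IsFASimple 𝒜 ψ) :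
    ∃ (ι : Type) (_ : Fintype ι) (π : Ω → ι) (c d : ι → ℝ), (∀ i, π ⁻¹' {i} ∈ 𝒜) ∧
      (φ = fun ω => c (π ω)) ∧ (ψ = fun ω => d (π ω)) := by
  have := hφ.1.fintype
  have := hψ.1.fintype
  refine ⟨range φ × range ψ, inferInstance, fun ω => (⟨φ ω, ω, rfl⟩, ⟨ψ ω, ω, rfl⟩),
    fun p => p.1, fun p => p.2, ?_, rfl, rfl⟩
  rintro ⟨⟨a, ha⟩, ⟨b, hb⟩⟩
  have : (fun ω => ((⟨φ ω, ω, rfl⟩, ⟨ψ ω, ω, rfl⟩) : range φ × range ψ)) ⁻¹' {(⟨a, ha⟩, ⟨b, hb⟩)}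
      = φ ⁻¹' {a} ∩ ψ ⁻¹' {b} := by
    ext ω; simp [Prod.ext_iff, Subtype.ext_iff]
  rw [this]
  exact h𝒜.inter_mem (hφ.2 a) (hψ.2 b)

theorem IsFASimple.comp₂ (h𝒜 : IsSetAlgebra 𝒜) {φ ψ : Ω → ℝ}
    (hφ : IsFASimple 𝒜 φ) (hψ : IsFASimple 𝒜 ψ) (F : ℝ → ℝ → ℝ) :
    IsFASimple 𝒜 (fun ω => F (φ ω) (ψ ω)) := by
  obtain ⟨ι, _, π, c, d, hπ, rfl, rfl⟩ := hφ.exists_common_partition h𝒜 hψ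
  exact isFASimple_comp h𝒜 hπ fun i => F (c i) (d i)

theorem IsFASimple.preimage_mem (h𝒜 : IsSetAlgebra 𝒜) {φ : Ω → ℝ} (hφ : IsFASimple 𝒜 φ)
    (t : Set ℝ) : φ ⁻¹' t ∈ 𝒜 := by
  classical
  have h := (hφ.comp₂ h𝒜 hφ fun x _ => if x ∈ t then 1 else 0).2 1
  convert h using 1
  ext ω; simp

theorem simpleIntegral_sub (h𝒜 : IsSetAlgebra 𝒜) (m : AddContent ℝ≥0 𝒜) {φ ψ : Ω → ℝ}
    (hφ : IsFASimple 𝒜 φ) (hψ : IsFASimple 𝒜 ψ) :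
    simpleIntegral m (fun ω => φ ω - ψ ω) = simpleIntegral m φ - simpleIntegral m ψ := by
  obtain ⟨ι, _, π, c, d, hπ, rfl, rfl⟩ := hφ.exists_common_partition h𝒜 hψ
  rw [simpleIntegral_comp h𝒜 m hπ c, simpleIntegral_comp h𝒜 m hπ d,
    simpleIntegral_comp h𝒜 m hπ fun i => c i - d i, ← Finset.sum_sub_distrib]
  exact Finset.sum_congr rfl fun i _ => sub_mul _ _ _

theorem simpleIntegral_add (h𝒜 : IsSetAlgebra 𝒜) (m : AddContent ℝ≥0 𝒜) {φ ψ : Ω → ℝ}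
    (hφ : IsFASimple 𝒜 φ) (hψ : IsFASimple 𝒜 ψ) :
    simpleIntegral m (fun ω => φ ω + ψ ω) = simpleIntegral m φ + simpleIntegral m ψ := by
  obtain ⟨ι, _, π, c, d, hπ, rfl, rfl⟩ := hφ.exists_common_partition h𝒜 hψ
  rw [simpleIntegral_comp h𝒜 m hπ c, simpleIntegral_comp h𝒜 m hπ d,
    simpleIntegral_comp h𝒜 m hπ fun i => c i + d i, ← Finset.sum_add_distrib]
  exact Finset.sum_congr rfl fun i _ => add_mul _ _ _

theorem simpleIntegral_mono (h𝒜 : IsSetAlgebra 𝒜) (m : AddContent ℝ≥0 𝒜) {φ ψ : Ω → ℝ}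
    (hφ : IsFASimple 𝒜 φ) (hψ : IsFASimple 𝒜 ψ) (h : φ ≤ ψ) :
    simpleIntegral m φ ≤ simpleIntegral m ψ := by
  obtain ⟨ι, _, π, c, d, hπ, rfl, rfl⟩ := hφ.exists_common_partition h𝒜 hψ
  rw [simpleIntegral_comp h𝒜 m hπ c, simpleIntegral_comp h𝒜 m hπ d]
  refine Finset.sum_le_sum fun i _ => ?_
  -- The coefficients can be compared only on cells that contain a point; empty cells have content
  -- zero.
  rcases (π ⁻¹' {i}).eq_empty_or_nonempty with he | ⟨ω, hω⟩
  · simp [he]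
  · have hi : π ω = i := hω
    have := h ω
    simp only [hi] at this
    gcongr

theorem abs_simpleIntegral_le (h𝒜 : IsSetAlgebra 𝒜) (m : AddContent ℝ≥0 𝒜) {φ : Ω → ℝ}
    (hφ : IsFASimple 𝒜 φ) : |simpleIntegral m φ| ≤ simpleIntegral m (fun ω => |φ ω|) := by
  obtain ⟨ι, _, π, c, -, hπ, rfl, -⟩ := hφ.exists_common_partition h𝒜 hφ
  rw [simpleIntegral_comp h𝒜 m hπ c, simpleIntegral_comp h𝒜 m hπ fun i => |c i|]
  refine (Finset.abs_sum_le_sum_abs _ _).trans_eq (Finset.sum_congr rfl fun i _ => ?_)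
  rw [abs_mul, abs_of_nonneg (NNReal.coe_nonneg _)]

theorem isFASimple_indicator (h𝒜 : IsSetAlgebra 𝒜) {A : Set Ω} (hA : A ∈ 𝒜) (a : ℝ) :
    IsFASimple 𝒜 (A.indicator fun _ => a) := by
  classical
  have h := isFASimple_comp (𝒜 := 𝒜) h𝒜 (ι := Prop) (π := fun ω => ω ∈ A) (fun p => ?_)
    (fun p => if p then a else 0)
  · convert h using 1
    ext ω
    simp [indicator_apply]
  · by_cases hp : p
    · convert hA using 1
      ext ω; simp [hp]
    · convert h𝒜.compl_mem hA using 1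
      ext ω; simp [hp]

theorem simpleIntegral_indicator (m : AddContent ℝ≥0 𝒜) {A : Set Ω} (a : ℝ) :
    simpleIntegral m (A.indicator fun _ => a) = a * m A := by
  rcases eq_or_ne a 0 with rfl | ha
  · have : ∀ y : ℝ, y * (m ((A.indicator fun _ => (0 : ℝ)) ⁻¹' {y}) : ℝ) = 0 := by
      intro y
      rcases eq_or_ne y 0 with rfl | hy
      · exact zero_mul _
      · have : (A.indicator fun _ => (0 : ℝ)) ⁻¹' {y} = ∅ := by
          ext ω; simp [hy.symm]
        rw [this, addContent_empty, NNReal.coe_zero, mul_zero]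
    rw [simpleIntegral, finsum_congr this, finsum_zero, zero_mul]
  · rw [simpleIntegral, finsum_eq_single _ a]
    · congr 3
      ext ω
      by_cases h : ω ∈ A <;> simp [h, ha.symm]
    · intro y hy
      rcases eq_or_ne y 0 with rfl | hy'
      · simp
      · have : (A.indicator fun _ => a) ⁻¹' {y} = ∅ := by
          ext ω
          by_cases h : ω ∈ A <;> simp [h, hy.symm, hy'.symm]
        simp [this]

theorem addContent_mono' (h𝒜 : IsSetAlgebra 𝒜) (m : AddContent ℝ≥0 𝒜) {A B : Set Ω}
    (hA : A ∈ 𝒜) (hB : B ∈ 𝒜) (h : A ⊆ B) : m A ≤ m B :=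
  addContent_mono h𝒜.isSetRing.isSetSemiring hA hB h

theorem outerContent_le (m : AddContent ℝ≥0 𝒜) {E A : Set Ω} (hA : A ∈ 𝒜) (h : E ⊆ A) :
    outerContent m E ≤ m A :=
  csInf_le (OrderBot.bddBelow _) ⟨A, hA, h, rfl⟩

theorem exists_addContent_lt_outerContent_add (h𝒜 : IsSetAlgebra 𝒜) (m : AddContent ℝ≥0 𝒜)
    (E : Set Ω) {ε : ℝ≥0} (hε : 0 < ε) : ∃ A ∈ 𝒜, E ⊆ A ∧ m A < outerContent m E + ε := by
  obtain ⟨_, ⟨A, hA, hE, rfl⟩, h⟩ := exists_lt_of_csInf_lt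
    (s := {r | ∃ A ∈ 𝒜, E ⊆ A ∧ m A = r}) ⟨m univ, univ, h𝒜.univ_mem, subset_univ E, rfl⟩
    (lt_add_of_pos_right (outerContent m E) hε)
  exact ⟨A, hA, hE, h⟩

theorem outerContent_eq (h𝒜 : IsSetAlgebra 𝒜) (m : AddContent ℝ≥0 𝒜) {A : Set Ω} (hA : A ∈ 𝒜) :
    outerContent m A = m A := by
  refine le_antisymm (outerContent_le m hA subset_rfl) (le_of_forall_pos_le_add fun ε hε => ?_)
  obtain ⟨B, hB, hAB, h⟩ := exists_addContent_lt_outerContent_add h𝒜 m A hε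
  exact (addContent_mono' h𝒜 m hA hB hAB).trans h.le

theorem outerContent_union_le (h𝒜 : IsSetAlgebra 𝒜) (m : AddContent ℝ≥0 𝒜) {E F G : Set Ω}
    (h : E ⊆ F ∪ G) : outerContent m E ≤ outerContent m F + outerContent m G := by
  refine le_of_forall_pos_le_add fun ε hε => ?_
  obtain ⟨A, hA, hFA, h1⟩ := exists_addContent_lt_outerContent_add h𝒜 m F (half_pos hε)
  obtain ⟨B, hB, hGB, h2⟩ := exists_addContent_lt_outerContent_add h𝒜 m G (half_pos hε)
  calc outerContent m E ≤ m (A ∪ B) :=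
        outerContent_le m (h𝒜.union_mem hA hB) (h.trans (union_subset_union hFA hGB))
    _ ≤ m A + m B := addContent_union_le h𝒜.isSetRing hA hB
    _ ≤ (outerContent m F + ε / 2) + (outerContent m G + ε / 2) := by gcongr
    _ = outerContent m F + outerContent m G + ε := by
      rw [add_add_add_comm, add_halves]

/-- A sequence of simple functions which is Cauchy in mean and tends to `0` in content tends to `0`
in mean. -/
theorem IsDeterminingSequence.tendsto_simpleIntegral_abs (h𝒜 : IsSetAlgebra 𝒜)
    {m : AddContent ℝ≥0 𝒜} {θ : ℕ → Ω → ℝ} (h : IsDeterminingSequence m θ fun _ => 0) :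
    Tendsto (fun n => simpleIntegral m fun ω => |θ n ω|) atTop (𝓝 0) := by
  have hnn : ∀ n, 0 ≤ simpleIntegral m fun ω => |θ n ω| := fun n =>
    (abs_nonneg _).trans (abs_simpleIntegral_le h𝒜 m (h.simple n))
  rw [Metric.tendsto_atTop]
  intro ε hε
  have hc := h.cauchy
  rw [Metric.tendsto_atTop] at hc
  obtain ⟨⟨N₁, N₂⟩, hN⟩ := hc (ε / 4) (by positivity)
  set N := max N₁ N₂
  obtain ⟨M, hM0, hM⟩ : ∃ M : ℝ, 0 < M ∧ ∀ ω, |θ N ω| ≤ M := by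
    obtain ⟨M, hM⟩ := (h.simple N).1.isBounded.exists_norm_le
    exact ⟨max M 1, by positivity, fun ω => (hM _ ⟨ω, rfl⟩).trans (le_max_left _ _)⟩
  -- The choice makes `c * m univ ≤ ε / 4`; the `+ 1` keeps the denominator positive.
  set c : ℝ := ε / (4 * (m univ + 1)) with hcdef
  have hc0 : 0 < c := by positivity
  have hcm : c * m univ ≤ ε / 4 := by
    rw [hcdef, div_mul_eq_mul_div, div_le_div_iff₀ (by positivity) (by positivity)]
    nlinarith [NNReal.coe_nonneg (m univ)]
  have hconv := (NNReal.tendsto_coe.2 (h.converges c hc0))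
  rw [NNReal.coe_zero, Metric.tendsto_atTop] at hconv
  obtain ⟨K, hK⟩ := hconv (ε / (4 * M)) (by positivity)
  refine ⟨max N K, fun n hn => ?_⟩
  have h1 := hN (n, N) ⟨(le_max_left _ _).trans ((le_max_left _ _).trans hn), le_max_right _ _⟩
  have h2 := hK n ((le_max_right _ _).trans hn)
  rw [Real.dist_0_eq_abs] at h1 h2 ⊢
  rw [abs_of_nonneg (hnn n)]
  have hE : {ω | c < |θ n ω - 0|} ∈ 𝒜 := by
    simpa using (h.simple n).preimage_mem h𝒜 {x | c < |x|}
  set E := {ω | c < |θ n ω - 0|} with hEdef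
  rw [outerContent_eq h𝒜 m hE, abs_of_nonneg (NNReal.coe_nonneg _), lt_div_iff₀ (by positivity)]
    at h2
  have sD : IsFASimple 𝒜 (fun ω => |θ n ω - θ N ω|) :=
    (h.simple n).comp₂ h𝒜 (h.simple N) fun x y => |x - y|
  have sU := isFASimple_indicator h𝒜 h𝒜.univ_mem c
  have sE := isFASimple_indicator h𝒜 hE M
  have s1 : IsFASimple 𝒜 (fun ω => (univ : Set Ω).indicator (fun _ => c) ω
      + |θ n ω - θ N ω|) := sU.comp₂ h𝒜 sD (· + ·)
  have s2 : IsFASimple 𝒜 (fun ω => ((univ : Set Ω).indicator (fun _ => c) ω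
      + |θ n ω - θ N ω|) + E.indicator (fun _ => M) ω) := s1.comp₂ h𝒜 sE (· + ·)
  -- Pointwise, `|θ n| ≤ c + |θ n - θ N| + M 1_E`: off `E` the first term suffices, and on `E` the
  -- fixed function `θ N` is bounded by `M`. Each of the three integrals is at most `ε / 4`.
  have h3 := simpleIntegral_mono h𝒜 m (φ := fun ω => |θ n ω|)
    ((h.simple n).comp₂ h𝒜 (h.simple n) fun x _ => |x|) s2 (fun ω => by
      have hMω := hM ω
      have htri : |θ n ω| ≤ |θ n ω - θ N ω| + |θ N ω| := by
        simpa using abs_add_le (θ n ω - θ N ω) (θ N ω)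
      by_cases hω : ω ∈ E
      · simp only [indicator_univ, hω, indicator_of_mem]
        linarith
      · simp only [indicator_univ, hω, not_false_eq_true, indicator_of_notMem]
        have : |θ n ω| ≤ c := by simpa [hEdef] using hω
        linarith [abs_nonneg (θ n ω - θ N ω)])
  rw [simpleIntegral_add h𝒜 m s1 sE, simpleIntegral_add h𝒜 m sU sD, simpleIntegral_indicator,
    simpleIntegral_indicator] at h3
  have h4 := le_abs_self (simpleIntegral m fun ω => |θ n ω - θ N ω|)
  simp only at h1
  nlinarith

theorem IsDeterminingSequence.sub (h𝒜 : IsSetAlgebra 𝒜) {m : AddContent ℝ≥0 𝒜}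
    {φ ψ : ℕ → Ω → ℝ} {g : Ω → ℝ} (hφ : IsDeterminingSequence m φ g)
    (hψ : IsDeterminingSequence m ψ g) :
    IsDeterminingSequence m (fun n ω => φ n ω - ψ n ω) fun _ => 0 where
  simple n := (hφ.simple n).comp₂ h𝒜 (hψ.simple n) (· - ·)
  converges c hc := by
    have h := (hφ.converges (c / 2) (half_pos hc)).add (hψ.converges (c / 2) (half_pos hc))
    rw [add_zero] at h
    refine tendsto_of_tendsto_of_tendsto_of_le_of_le tendsto_const_nhds h (fun _ => zero_le)
      fun n => outerContent_union_le h𝒜 m fun ω hω => ?_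
    by_contra hcon
    simp only [mem_union, mem_ofPred_eq, not_or, not_lt, sub_zero] at hcon hω
    have := abs_sub_le (φ n ω) (g ω) (ψ n ω)
    rw [abs_sub_comm (g ω)] at this
    linarith [hcon.1, hcon.2]
  cauchy := by
    have h := hφ.cauchy.add hψ.cauchy
    rw [add_zero] at h
    have s1 : ∀ p : ℕ × ℕ, IsFASimple 𝒜 (fun ω => |φ p.1 ω - φ p.2 ω|) := fun p =>
      (hφ.simple p.1).comp₂ h𝒜 (hφ.simple p.2) fun x y => |x - y|
    have s2 : ∀ p : ℕ × ℕ, IsFASimple 𝒜 (fun ω => |ψ p.1 ω - ψ p.2 ω|) := fun p =>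
      (hψ.simple p.1).comp₂ h𝒜 (hψ.simple p.2) fun x y => |x - y|
    have s3 : ∀ p : ℕ × ℕ, IsFASimple 𝒜
        (fun ω => (φ p.1 ω - ψ p.1 ω) - (φ p.2 ω - ψ p.2 ω)) := fun p =>
      ((hφ.simple p.1).comp₂ h𝒜 (hψ.simple p.1) (· - ·)).comp₂ h𝒜
        ((hφ.simple p.2).comp₂ h𝒜 (hψ.simple p.2) (· - ·)) (· - ·)
    refine tendsto_of_tendsto_of_tendsto_of_le_of_le tendsto_const_nhds h
      (fun p => (abs_nonneg _).trans (abs_simpleIntegral_le h𝒜 m (s3 p))) fun p => ?_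
    dsimp only
    rw [← simpleIntegral_add h𝒜 m (s1 p) (s2 p)]
    refine simpleIntegral_mono h𝒜 m ((s3 p).comp₂ h𝒜 (s3 p) fun x _ => |x|)
      ((s1 p).comp₂ h𝒜 (s2 p) (· + ·)) fun ω => ?_
    dsimp only
    rw [sub_sub_sub_comm]
    exact abs_sub _ _

/-- The difference of two determining sequences tends to `0` in content and is Cauchy in mean, hence
tends to `0` in mean. This is what identifies an integral coming from Pettis integrability with one
coming from the representation. -/
theorem HasFAIntegral.unique (h𝒜 : IsSetAlgebra 𝒜) {m : AddContent ℝ≥0 𝒜} {g : Ω → ℝ} {I J : ℝ}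
    (hI : HasFAIntegral m g I) (hJ : HasFAIntegral m g J) : I = J := by
  obtain ⟨φ, hφ, hφI⟩ := hI
  obtain ⟨ψ, hψ, hψJ⟩ := hJ
  have hd := hφ.sub h𝒜 hψ
  have h1 := squeeze_zero_norm (f := fun n => simpleIntegral m fun ω => φ n ω - ψ n ω)
    (fun n => abs_simpleIntegral_le h𝒜 m (hd.simple n))
    (hd.tendsto_simpleIntegral_abs h𝒜)
  have h2 := hφI.sub hψJ
  simp only [simpleIntegral_sub h𝒜 m (hφ.simple _) (hψ.simple _)] at h1
  exact sub_eq_zero.mp (tendsto_nhds_unique h2 h1)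

theorem hasFAIntegral_indicator (h𝒜 : IsSetAlgebra 𝒜) (m : AddContent ℝ≥0 𝒜) {A : Set Ω}
    (hA : A ∈ 𝒜) : HasFAIntegral m (A.indicator fun _ => 1) (m A) := by
  refine ⟨fun _ => A.indicator fun _ => 1,
    ⟨fun _ => isFASimple_indicator h𝒜 hA 1, fun c hc => ?_, ?_⟩, ?_⟩
  · have h1 : outerContent m (∅ : Set Ω) = 0 := by
      rw [outerContent_eq h𝒜 m h𝒜.empty_mem, addContent_empty]
    simp [hc.not_gt, h1]
  · have := simpleIntegral_indicator m (A := ∅) 0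
    simp only [indicator_empty, zero_mul] at this
    simp [this]
  · simp only [simpleIntegral_indicator, one_mul]
    exact tendsto_const_nhds

end FiniteAdditivity

/-! ### Functionals on a dual space that are evaluations. -/

section BanachSpace

theorem isClosed_range_linearIsometry {E F : Type*} [NormedAddCommGroup E] [NormedSpace ℝ E]
    [CompleteSpace E] [NormedAddCommGroup F] [NormedSpace ℝ F] (i : E →ₗᵢ[ℝ] F) :
    IsClosed (range i) :=
  i.isometry.isClosedEmbedding.isClosed_range

theorem IsClosed.mem_of_forall_exists_norm_sub_le {E : Type*} [NormedAddCommGroup E] {s : Set E}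
    (hs : IsClosed s) {x : E} (h : ∀ ε : ℝ, 0 < ε → ∃ y ∈ s, ‖x - y‖ ≤ ε) : x ∈ s := by
  rw [← hs.closure_eq, Metric.mem_closure_iff]
  intro ε hε
  obtain ⟨y, hy, hxy⟩ := h (ε / 2) (half_pos hε)
  exact ⟨y, hy, by rw [dist_eq_norm]; linarith⟩

theorem IsClosed.mem_of_tendsto_norm_sub {E : Type*} [NormedAddCommGroup E] {s : Set E}
    (hs : IsClosed s) {x : E} {u : ℕ → E} (hu : ∀ n, u n ∈ s) {c : ℕ → ℝ}
    (hc : ∀ n, ‖x - u n‖ ≤ c n) (hlim : Tendsto c atTop (𝓝 0)) : x ∈ s := by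
  refine hs.mem_of_forall_exists_norm_sub_le fun ε hε => ?_
  obtain ⟨n, hn⟩ := (hlim.eventually_le_const hε).exists
  exact ⟨u n, hu n, (hc n).trans hn⟩

/-- The restriction of `Φ` to `N` has norm at most `ε`; Hahn–Banach extends it without increasing
the norm. -/
theorem exists_norm_le_eqOn_submodule {E : Type*} [NormedAddCommGroup E] [NormedSpace ℝ E]
    (Φ : StrongDual ℝ E) (N : Submodule ℝ E) {ε : ℝ} (hε : 0 ≤ ε)
    (h : ∀ x ∈ N, ‖x‖ ≤ 1 → |Φ x| ≤ ε) :
    ∃ Ψ : StrongDual ℝ E, ‖Ψ‖ ≤ ε ∧ ∀ x ∈ N, Ψ x = Φ x := by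
  obtain ⟨Ψ, hΨ, hΨn⟩ := exists_extension_norm_eq N (Φ.comp N.subtypeL)
  refine ⟨Ψ, hΨn.trans_le ?_, fun x hx => hΨ ⟨x, hx⟩⟩
  exact ContinuousLinearMap.opNorm_le_of_unit_norm hε fun x hx => h x x.2 hx.le

theorem isClosed_range_inclusionInDoubleDual (X : Type*) [NormedAddCommGroup X] [NormedSpace ℝ X]
    [CompleteSpace X] : IsClosed (range (NormedSpace.inclusionInDoubleDual ℝ X)) := by
  have h := isClosed_range_linearIsometry (F := StrongDual ℝ (StrongDual ℝ X))
    (NormedSpace.inclusionInDoubleDualLi (E := X) ℝ)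
  exact h

/-- A functional on `X*` which is small on the intersection of the unit ball with the annihilator of
finitely many vectors is close to the evaluation at some vector. -/
theorem exists_norm_sub_inclusionInDoubleDual_le {X : Type*} [NormedAddCommGroup X]
    [NormedSpace ℝ X] (Φ : StrongDual ℝ (StrongDual ℝ X)) (F : Finset X) {ε : ℝ} (hε : 0 ≤ ε)
    (h : ∀ x' : StrongDual ℝ X, ‖x'‖ ≤ 1 → (∀ x ∈ F, x' x = 0) → |Φ x'| ≤ ε) :
    ∃ x : X, ‖Φ - NormedSpace.inclusionInDoubleDual ℝ X x‖ ≤ ε := by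
  let J : X →ₗ[ℝ] Module.Dual ℝ (StrongDual ℝ X) :=
    ContinuousLinearMap.coeLM ℝ ∘ₗ (NormedSpace.inclusionInDoubleDual ℝ X : X →ₗ[ℝ] _)
  have hJ : ∀ x x', J x x' = x' x := fun x x' => rfl
  let N : Submodule ℝ (StrongDual ℝ X) := ⨅ x : F, LinearMap.ker (J x)
  have hN : ∀ x' ∈ N, ∀ x ∈ F, x' x = 0 := by
    intro x' hx' x hx
    have := (Submodule.mem_iInf _).1 hx' ⟨x, hx⟩
    simpa [hJ] using this
  obtain ⟨Ψ, hΨn, hΨ⟩ := exists_norm_le_eqOn_submodule Φ N hε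
    fun x' hx' hx1 => h x' hx1 (hN x' hx')
  have hker : N ≤
      LinearMap.ker ((Φ - Ψ : StrongDual ℝ (StrongDual ℝ X)) : StrongDual ℝ X →ₗ[ℝ] ℝ) := by
    intro x' hx'
    simp [hΨ x' hx']
  -- `Φ - Ψ` vanishes on the common kernel of finitely many evaluations, so it is a linear
  -- combination of them, hence itself an evaluation.
  have hmem := mem_span_of_iInf_ker_le_ker hker
  have hle : Submodule.span ℝ (range fun x : F => J x) ≤ LinearMap.range J :=
    Submodule.span_le.2 (by rintro _ ⟨x, rfl⟩; exact ⟨x, rfl⟩)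
  obtain ⟨x, hx⟩ := hle hmem
  refine ⟨x, ?_⟩
  have : Φ - NormedSpace.inclusionInDoubleDual ℝ X x = Ψ := by
    ext x'
    have h1 := LinearMap.congr_fun hx x'
    rw [hJ] at h1
    simp only [ContinuousLinearMap.coe_coe, sub_apply, NormedSpace.dual_def] at h1 ⊢
    linarith
  rw [this]
  exact hΨn

/-- A functional on the dual of a Banach space is an evaluation as soon as it is weak* continuous on
the closed unit ball. -/
theorem mem_range_inclusionInDoubleDual_of_continuous_ball {X : Type*} [NormedAddCommGroup X]
    [NormedSpace ℝ X] [CompleteSpace X] (Φ : StrongDual ℝ (StrongDual ℝ X))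
    (h : Continuous fun x' : {x' : WeakDual ℝ X // ‖WeakDual.toStrongDual x'‖ ≤ 1} =>
      Φ (WeakDual.toStrongDual x'.1)) :
    Φ ∈ range (NormedSpace.inclusionInDoubleDual ℝ X) := by
  refine (isClosed_range_inclusionInDoubleDual X).mem_of_forall_exists_norm_sub_le ?_
  intro ε hε
  let z : {x' : WeakDual ℝ X // ‖WeakDual.toStrongDual x'‖ ≤ 1} := ⟨0, by simp⟩
  have h0 : {x' : {x' : WeakDual ℝ X // ‖WeakDual.toStrongDual x'‖ ≤ 1} |
      |Φ (WeakDual.toStrongDual x'.1)| ≤ ε} ∈ 𝓝 z := by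
    have h1 := h.abs.continuousAt (x := z)
    refine h1.eventually_le_const ?_ |>.mono fun _ h => h
    simpa [z] using hε
  have hemb : IsInducing fun (x' : {x' : WeakDual ℝ X // ‖WeakDual.toStrongDual x'‖ ≤ 1}) (x : X) =>
      x'.1 x :=
    (IsInducing.induced (fun (x' : WeakDual ℝ X) (x : X) => x' x)).comp IsInducing.subtypeVal
  rw [hemb.nhds_eq_comap, mem_comap] at h0
  obtain ⟨t, ht, hsub⟩ := h0
  rw [nhds_pi, Filter.mem_pi'] at ht
  -- The weak* topology is that of pointwise convergence, so only finitely many vectors `F`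
  -- constrain the neighbourhood. A functional in the ball that vanishes on `F` agrees there with
  -- `0` and lies in it.
  obtain ⟨F, u, hu, hut⟩ := ht
  obtain ⟨x, hx⟩ := exists_norm_sub_inclusionInDoubleDual_le Φ F hε.le
    (fun x' hx' hF => hsub (a := ⟨StrongDual.toWeakDual x', by simpa using hx'⟩) (hut fun x hx => by
      have h1 : (StrongDual.toWeakDual x' : WeakDual ℝ X) x = 0 := hF x hx
      have h2 := mem_of_mem_nhds (hu x)
      have h3 : z.1 x = 0 := rfl
      simp only at h2 ⊢
      rw [h1]; rwa [h3] at h2))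
  exact ⟨_, ⟨x, rfl⟩, hx⟩

end BanachSpace

/-! ### The dual of `L¹` of a finite measure. -/

section Duality

variable {S : Type*} [MeasurableSpace S] {μ : Measure S} [IsFiniteMeasure μ]

/-- Every bounded functional on `L¹(μ)` is given by an element of `L^∞(μ)`. -/
theorem exists_Lp_top_forall_eq_integral_mul (l : StrongDual ℝ (Lp ℝ 1 μ)) :
    ∃ b : Lp ℝ ∞ μ, ∀ h : Lp ℝ 1 μ, l h = ∫ s, b s * h s ∂μ := by
  -- The inclusion of `L²` into `L¹`, written as Hölder multiplication by the constant `1`. The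
  -- density `b` then comes from the Riesz representation of `l ∘ j` on `L²`.
  let j : Lp ℝ 2 μ →L[ℝ] Lp ℝ 1 μ := (ContinuousLinearMap.mul ℝ ℝ).holderL μ 2 2 1
    (indicatorConstLp 2 MeasurableSet.univ (measure_ne_top μ univ) 1)
  have hj : ∀ {E : Set S} (hE : MeasurableSet E),
      j (indicatorConstLp 2 hE (measure_ne_top μ E) 1)
        = indicatorConstLp 1 hE (measure_ne_top μ E) 1 := by
    intro E hE
    ext1
    refine ((ContinuousLinearMap.mul ℝ ℝ).coeFn_holder _ _).trans ?_
    filter_upwards [indicatorConstLp_coeFn (p := 2) (hs := MeasurableSet.univ)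
      (hμs := measure_ne_top μ univ) (c := (1 : ℝ)),
      indicatorConstLp_coeFn (p := 2) (hs := hE) (hμs := measure_ne_top μ E) (c := (1 : ℝ)),
      indicatorConstLp_coeFn (p := 1) (hs := hE) (hμs := measure_ne_top μ E) (c := (1 : ℝ))]
      with s h1 h2 h3
    rw [h1, h2, h3]
    simp
  let b := (InnerProductSpace.toDual ℝ (Lp ℝ 2 μ)).symm (l.comp j)
  have hb : ∀ {E : Set S} (hE : MeasurableSet E),
      l (indicatorConstLp 1 hE (measure_ne_top μ E) 1) = ∫ s in E, b s ∂μ := by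
    intro E hE
    rw [← L2.inner_indicatorConstLp_one (𝕜 := ℝ) hE (measure_ne_top μ E) b, real_inner_comm,
      InnerProductSpace.toDual_symm_apply, ContinuousLinearMap.comp_apply, hj]
  have hbi : Integrable b μ := (Lp.memLp b).integrable one_le_two
  have hle : ∀ {E : Set S}, MeasurableSet E → |∫ s in E, b s ∂μ| ≤ ∫ _ in E, ‖l‖ ∂μ := by
    intro E hE
    rw [← hb hE, setIntegral_const, smul_eq_mul, mul_comm]
    refine (l.le_opNorm _).trans_eq ?_
    rw [norm_indicatorConstLp one_ne_zero ENNReal.one_ne_top]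
    simp
  have h1 : b ≤ᵐ[μ] fun _ => ‖l‖ := ae_le_of_forall_setIntegral_le hbi (integrable_const _)
    fun E hE _ => (le_abs_self _).trans (hle hE)
  have h2 : (fun s => -b s) ≤ᵐ[μ] fun _ => ‖l‖ :=
    ae_le_of_forall_setIntegral_le hbi.neg (integrable_const _) fun E hE _ => by
      rw [integral_neg]
      exact (neg_le_abs _).trans (hle hE)
  have hmem : MemLp b ∞ μ := memLp_top_of_bound hbi.aestronglyMeasurable ‖l‖ (by
    filter_upwards [h1, h2] with s h3 h4
    exact abs_le'.2 ⟨h3, h4⟩)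
  refine ⟨hmem.toLp b, ?_⟩
  have key : ∀ h, l h = (ContinuousLinearMap.mul ℝ ℝ).lpPairing μ ∞ 1 (hmem.toLp b) h := by
    intro h
    induction h using Lp.induction ENNReal.one_ne_top with
    | indicatorConst c hE hμE =>
      rename_i E
      have h3 : ((Lp.simpleFunc.indicatorConst 1 hE hμE.ne c : Lp.simpleFunc ℝ 1 μ) : Lp ℝ 1 μ)
          = c • indicatorConstLp 1 hE (measure_ne_top μ E) (1 : ℝ) := by
        rw [Lp.simpleFunc.coe_indicatorConst]
        ext1
        refine indicatorConstLp_coeFn.trans (EventuallyEq.trans ?_ (Lp.coeFn_smul _ _).symm)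
        filter_upwards [indicatorConstLp_coeFn (p := 1) (hs := hE) (hμs := measure_ne_top μ E)
          (c := (1 : ℝ))] with s hs
        by_cases h4 : s ∈ E <;> simp [hs, h4]
      rw [h3, map_smul, map_smul, hb hE, ContinuousLinearMap.lpPairing_eq_integral,
        ← integral_indicator hE]
      congr 1
      refine integral_congr_ae ?_
      filter_upwards [hmem.coeFn_toLp,
        indicatorConstLp_coeFn (p := 1) (hs := hE) (hμs := measure_ne_top μ E) (c := (1 : ℝ))]
        with s h4 h5
      rw [h4, h5]
      by_cases hs : s ∈ E <;> simp [hs]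
    | add f g _ hf hg => rw [map_add, map_add, hf, hg]
    | isClosed => exact isClosed_eq l.continuous (ContinuousLinearMap.continuous _)
  intro h
  rw [key, ContinuousLinearMap.lpPairing_eq_integral]
  rfl

end Duality

/-! ### Approximation of Borel sets by clopen sets. -/

section Clopen

variable {S : Type*} [TopologicalSpace S] [CompactSpace S] [T2Space S] [MeasurableSpace S]
  [BorelSpace S]

/-- Clopen sets are dense in the measure algebra of a regular measure if the continuous functions
are measurable for the σ-algebra they generate. -/
theorem measureDense_isClopen (μ : Measure S) [IsFiniteMeasure μ] [μ.Regular]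
    (h : ∀ g : C(S, ℝ), Measurable[MeasurableSpace.generateFrom {E : Set S | IsClopen E}] g) :
    μ.MeasureDense {E : Set S | IsClopen E} where
  measurable E hE := hE.isOpen.measurableSet
  approx E hE _ ε hε := by
    have hm : MeasurableSpace.generateFrom {E : Set S | IsClopen E} ≤ ‹MeasurableSpace S› :=
      MeasurableSpace.generateFrom_le fun E hE => IsOpen.measurableSet (IsClopen.isOpen hE)
    have halg : IsSetAlgebra {E : Set S | IsClopen E} :=
      { empty_mem := isClopen_empty
        compl_mem := fun _ hE => IsClopen.compl hE
        union_mem := fun _ _ hE hF => IsClopen.union hE hF }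
    have hε' : ENNReal.ofReal (ε / 4) ≠ 0 := by simpa using hε
    obtain ⟨K, hKE, hK, hEK⟩ := hE.exists_isCompact_sdiff_lt (measure_ne_top μ E) hε'
    obtain ⟨U, hKU, hU, hUK⟩ := hK.exists_isOpen_lt_add (μ := μ) hε'
    obtain ⟨g, hg0, hg1, -⟩ := exists_continuous_zero_one_of_isClosed hU.isClosed_compl hK.isClosed
      (disjoint_compl_left_iff_subset.2 hKU)
    -- A level set of the Urysohn function lies between `K` and `U` and belongs to the σ-algebra
    -- generated by the clopen sets. It differs from `E` only inside `(E \ K) ∪ (U \ K)`.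
    set B : Set S := g ⁻¹' Ioi (1 / 2) with hB
    have hBm : MeasurableSet[MeasurableSpace.generateFrom {E : Set S | IsClopen E}] B :=
      h g measurableSet_Ioi
    have hKB : K ⊆ B := fun s hs => by
      have : g s = 1 := hg1 hs
      rw [hB, mem_preimage, this]; norm_num
    have hBU : B ⊆ U := fun s hs => by
      by_contra hsU
      have : g s = 0 := hg0 hsU
      rw [hB, mem_preimage, this] at hs; norm_num at hs
    have hEB : μ (symmDiff E B) ≤ ENNReal.ofReal (ε / 4) + ENNReal.ofReal (ε / 4) := by
      have h1 : symmDiff E B ⊆ (E \ K) ∪ (U \ K) := by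
        rintro s (⟨h1, h2⟩ | ⟨h1, h2⟩)
        · exact Or.inl ⟨h1, fun h => h2 (hKB h)⟩
        · exact Or.inr ⟨hBU h1, fun h => h2 (hKE h)⟩
      refine (measure_mono h1).trans ((measure_union_le _ _).trans (add_le_add hEK.le ?_))
      rw [measure_sdiff hKU hK.measurableSet.nullMeasurableSet (measure_ne_top μ K)]
      exact tsub_le_iff_left.2 hUK.le
    -- The clopen algebra need not generate the Borel sets, so `μ` is restricted to the σ-algebra it
    -- does generate; `B` lives there.
    have hd := @Measure.MeasureDense.of_generateFrom_isSetAlgebra_finite S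
      (MeasurableSpace.generateFrom {E : Set S | IsClopen E}) (μ.trim hm) _
      (isFiniteMeasure_trim hm) halg rfl
    obtain ⟨C, hC, hBC⟩ := @Measure.MeasureDense.approx S
      (MeasurableSpace.generateFrom {E : Set S | IsClopen E}) _ _ hd B hBm
      (@measure_ne_top S (MeasurableSpace.generateFrom {E : Set S | IsClopen E}) (μ.trim hm)
        (isFiniteMeasure_trim hm) B) (ε / 4) (by positivity)
    have hCm : MeasurableSet[MeasurableSpace.generateFrom {E : Set S | IsClopen E}] C :=
      MeasurableSpace.measurableSet_generateFrom hC
    rw [trim_measurableSet_eq hm (hBm.symmDiff hCm)] at hBC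
    refine ⟨C, hC, (measure_symmDiff_le E B C).trans_lt ?_⟩
    calc μ (symmDiff E B) + μ (symmDiff B C)
        ≤ ENNReal.ofReal (ε / 4) + ENNReal.ofReal (ε / 4) + ENNReal.ofReal (ε / 4) :=
          add_le_add hEB hBC.le
      _ = ENNReal.ofReal (ε / 4 + ε / 4 + ε / 4) := by
          rw [ENNReal.ofReal_add (by positivity) (by positivity),
            ENNReal.ofReal_add (by positivity) (by positivity)]
      _ < ENNReal.ofReal ε := (ENNReal.ofReal_lt_ofReal_iff hε).2 (by linarith)

end Clopen

/-! ### The image of `χ` in the measure algebra. -/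

theorem mem_contentCompletion {Ω : Type*} {𝒜 : Set (Set Ω)} (m : AddContent ℝ≥0 𝒜) {A : Set Ω}
    (hA : A ∈ 𝒜) : A ∈ contentCompletion m := fun ε hε =>
  ⟨A, hA, A, hA, subset_rfl, subset_rfl, by simpa using hε⟩

namespace AbstractStandardRepresentation

section Density

variable {Ω : Type*} {𝒜 : Set (Set Ω)} {X : Type*} {S : Type*} [TopologicalSpace S]
  [MeasurableSpace S] {m : AddContent ℝ≥0 𝒜} {f : Ω → X} {μ : Measure S}

theorem χ_mono (R : AbstractStandardRepresentation m f μ) {A B : Set Ω}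
    (hA : A ∈ contentCompletion m) (hB : B ∈ contentCompletion m) (h : A ⊆ B) :
    R.χ A ⊆ R.χ B := by
  have h1 := R.χ_union A hA B hB
  rw [union_eq_self_of_subset_left h] at h1
  rw [h1]
  exact subset_union_left

theorem χ_sdiff (R : AbstractStandardRepresentation m f μ) (h𝒜 : IsSetAlgebra 𝒜) {A B : Set Ω}
    (hA : A ∈ 𝒜) (hB : B ∈ 𝒜) : R.χ (B \ A) = R.χ B \ R.χ A := by
  have hBc := mem_contentCompletion m (h𝒜.compl_mem hB)
  have hU := mem_contentCompletion m (h𝒜.union_mem (h𝒜.compl_mem hB) hA)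
  have h1 : B \ A = (Bᶜ ∪ A)ᶜ := by rw [compl_union, compl_compl, sdiff_eq]
  rw [h1, R.χ_compl _ hU, R.χ_union _ hBc _ (mem_contentCompletion m hA),
    R.χ_compl _ (mem_contentCompletion m hB), compl_union, compl_compl, sdiff_eq]

/-- The integral identity is applied to the lift of the constant `1`: one side integrates `1_A`, the
other gives the measure of `χ(A)`. -/
theorem measureReal_χ (R : AbstractStandardRepresentation m f μ) (h𝒜 : IsSetAlgebra 𝒜)
    {A : Set Ω} (hA : A ∈ 𝒜) : μ.real (R.χ A) = m A := by
  have h1 : R.lift 1 ∈ LambdaSpace m f := by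
    have : R.lift 1 ∈ range R.lift := ⟨1, rfl⟩
    rw [R.range_lift] at this
    exact this.1
  have h2 := R.integral_eq A hA _ h1
  have h3 : ∫ s in R.χ A, R.T (R.lift 1) s ∂μ = μ.real (R.χ A) := by
    rw [integral_congr_ae (g := fun _ => (1 : ℝ)) (ae_restrict_of_ae (R.T_lift 1))]
    simp
  rw [h3] at h2
  simp only [map_one, Pi.one_apply] at h2
  exact h2.unique h𝒜 (hasFAIntegral_indicator h𝒜 m hA)

/-- The sets `χ(A)` with `A ∈ 𝒜` are dense in the measure algebra of `μ`. -/
theorem measureDense_χ [CompactSpace S] [T2Space S] [BorelSpace S] [IsFiniteMeasure μ] [μ.Regular]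
    (R : AbstractStandardRepresentation m f μ) (h𝒜 : IsSetAlgebra 𝒜) :
    μ.MeasureDense (R.χ '' 𝒜) where
  measurable := by
    rintro _ ⟨A, hA, rfl⟩
    exact (R.isClopen_χ A (mem_contentCompletion m hA)).isOpen.measurableSet
  approx E hE hμE ε hε := by
    obtain ⟨C, hC, hEC⟩ := (measureDense_isClopen μ R.measurable_continuous).approx E hE hμE
      (ε / 2) (half_pos hε)
    obtain ⟨D, hD, hCD⟩ := R.clopen_approx C hC
    obtain ⟨A, hA, B, hB, hAD, hDB, hAB⟩ := hD (ε / 2).toNNReal (by simpa using hε)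
    have hA' := mem_contentCompletion m hA
    have hB' := mem_contentCompletion m hB
    have h1 : μ (symmDiff (R.χ D) (R.χ A)) < ENNReal.ofReal (ε / 2) := by
      -- Both `D` and `A` lie between `A` and `B`, so their images differ only inside `χ(B \ A)`, of
      -- measure `m (B \ A)`.
      have h2 : symmDiff (R.χ D) (R.χ A) ⊆ R.χ (B \ A) := by
        rw [R.χ_sdiff h𝒜 hA hB]
        rintro s (⟨h3, h4⟩ | ⟨h3, h4⟩)
        · exact ⟨R.χ_mono hD hB' hDB h3, h4⟩
        · exact absurd (R.χ_mono hA' hD hAD h3) h4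
      have h3 := R.measureReal_χ h𝒜 (h𝒜.sdiff_mem hB hA)
      refine (measure_mono h2).trans_lt ?_
      rw [← ENNReal.ofReal_toReal (measure_ne_top μ (R.χ (B \ A))), ← measureReal_def, h3,
        ENNReal.ofReal_coe_nnreal]
      exact ENNReal.coe_lt_coe.2 hAB
    refine ⟨_, ⟨A, hA, rfl⟩, (measure_symmDiff_le E C (R.χ A)).trans_lt ?_⟩
    calc μ (symmDiff E C) + μ (symmDiff C (R.χ A))
        ≤ μ (symmDiff E C) + (μ (symmDiff C (R.χ D)) + μ (symmDiff (R.χ D) (R.χ A))) := by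
          gcongr
          exact measure_symmDiff_le _ _ _
      _ < ENNReal.ofReal (ε / 2) + ENNReal.ofReal (ε / 2) := by
          rw [hCD, zero_add]
          exact ENNReal.add_lt_add hEC h1
      _ = ENNReal.ofReal ε := by
          rw [← ENNReal.ofReal_add (by positivity) (by positivity), add_halves]

end Density

/-! ### Norm estimates and passage to the limit for `T₀*` and `F̃`. -/

section StandardVectorMeasure

variable {Ω : Type*} {𝒜 : Set (Set Ω)} {X : Type*} [NormedAddCommGroup X] [NormedSpace ℝ X]
  {S : Type*} [TopologicalSpace S] [MeasurableSpace S]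
  {m : AddContent ℝ≥0 𝒜} {f : Ω → X} {μ : Measure S}

/-- Integrating `|T₀ x'| ≤ ‖x'‖ • T(‖·‖)` against `|b|` gives a bound uniform in the unit ball of
`X*`. Norm integrability of `f` enters here, and all later limits rely on it. -/
theorem norm_T₀adj_le (R : AbstractStandardRepresentation m f μ) (hw : WeaklyIntegrable m f)
    (hn : NormIntegrable m f) (b : Lp ℝ ∞ μ) :
    ‖R.T₀adj hw hn b‖ ≤ ∫ s, |b s| * |R.T (ofNorm Ω X) s| ∂μ := by
  refine ContinuousLinearMap.opNorm_le_bound _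
    (integral_nonneg fun _ => mul_nonneg (abs_nonneg _) (abs_nonneg _)) fun x' => ?_
  have hi : Integrable (fun s => |b s| * |R.T (ofNorm Ω X) s|) μ :=
    MemLp.integrable_mul (p := ∞) (q := 1) (Lp.memLp b).abs (Lp.memLp (R.T (ofNorm Ω X))).abs
  rw [T₀adj_apply, mul_comm, ← integral_const_mul]
  refine norm_integral_le_of_norm_le (hi.const_mul _) ?_
  have h1 := R.abs_T_le hw hn x'
  rw [← Lp.coeFn_le] at h1
  filter_upwards [h1, Lp.coeFn_abs (R.T (ofDual Ω x')),
    Lp.coeFn_smul ‖x'‖ (R.T (ofNorm Ω X))] with s h2 h3 h4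
  rw [h3, h4] at h2
  rw [norm_mul, Real.norm_eq_abs, mul_left_comm]
  exact mul_le_mul_of_nonneg_left
    (h2.trans (mul_le_mul_of_nonneg_left (le_abs_self _) (norm_nonneg _))) (abs_nonneg _)

theorem norm_T₀adj_sub_le (R : AbstractStandardRepresentation m f μ) (hw : WeaklyIntegrable m f)
    (hn : NormIntegrable m f) (b c : Lp ℝ ∞ μ) :
    ‖R.T₀adj hw hn b - R.T₀adj hw hn c‖ ≤ ∫ s, |b s - c s| * |R.T (ofNorm Ω X) s| ∂μ := by
  have h : R.T₀adj hw hn b - R.T₀adj hw hn c = R.T₀adj hw hn (b - c) := by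
    have h1 := (R.T₀adj hw hn).map_add (b - c) c
    rw [sub_add_cancel] at h1
    ext x'
    rw [h1]
    simp only [sub_apply, add_apply, add_sub_cancel_right]
  rw [h]
  refine (R.norm_T₀adj_le hw hn _).trans_eq (integral_congr_ae ?_)
  filter_upwards [Lp.coeFn_sub b c] with s hs
  rw [hs, Pi.sub_apply]

theorem norm_stdVectorMeasure_sub_le [IsFiniteMeasure μ] (R : AbstractStandardRepresentation m f μ)
    (hw : WeaklyIntegrable m f) (hn : NormIntegrable m f) {E F : Set S} (hE : MeasurableSet E)
    (hF : MeasurableSet F) :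
    ‖R.stdVectorMeasure hw hn E - R.stdVectorMeasure hw hn F‖
      ≤ ∫ s in symmDiff E F, |R.T (ofNorm Ω X) s| ∂μ := by
  rw [stdVectorMeasure_apply _ _ _ hE, stdVectorMeasure_apply _ _ _ hF]
  refine (R.norm_T₀adj_sub_le hw hn _ _).trans_eq ?_
  rw [← integral_indicator (hE.symmDiff hF)]
  refine integral_congr_ae ?_
  filter_upwards [
    indicatorConstLp_coeFn (p := ∞) (hs := hE) (hμs := measure_ne_top μ E) (c := (1 : ℝ)),
    indicatorConstLp_coeFn (p := ∞) (hs := hF) (hμs := measure_ne_top μ F) (c := (1 : ℝ))]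
    with s h2 h3
  rw [h2, h3]
  by_cases h4 : s ∈ E <;> by_cases h5 : s ∈ F <;> simp [h4, h5, mem_symmDiff]

/-- `F̃(E)` is a norm limit of values `F̃(χ(A))`, which are Pettis integrals: the error is the
integral of `|T(‖·‖)|` over a set whose measure tends to `0`. -/
theorem stdVectorMeasure_mem_range_of_pettisIntegrable [CompleteSpace X] [CompactSpace S]
    [T2Space S] [BorelSpace S] [IsFiniteMeasure μ] [μ.Regular]
    (R : AbstractStandardRepresentation m f μ) (h𝒜 : IsSetAlgebra 𝒜)
    (hw : WeaklyIntegrable m f) (hn : NormIntegrable m f) (h : PettisIntegrable m f) {E : Set S}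
    (hE : MeasurableSet E) :
    R.stdVectorMeasure hw hn E ∈ range (NormedSpace.inclusionInDoubleDual ℝ X) := by
  have hχ : ∀ A ∈ 𝒜, R.stdVectorMeasure hw hn (R.χ A)
      ∈ range (NormedSpace.inclusionInDoubleDual ℝ X) := by
    intro A hA
    obtain ⟨x, hx⟩ := h A hA
    refine ⟨x, ?_⟩
    ext x'
    exact (hx x').unique h𝒜 (R.stdVectorMeasure_χ hw hn hA x')
  have hdense := R.measureDense_χ h𝒜
  choose t ht hlt using fun n : ℕ =>
    hdense.approx E hE (measure_ne_top μ E) (1 / ((n : ℝ) + 1)) (by positivity)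
  have h1 : Tendsto (fun n => μ (symmDiff E (t n))) atTop (𝓝 0) := by
    have h2 := ENNReal.tendsto_ofReal (tendsto_one_div_add_atTop_nhds_zero_nat (𝕜 := ℝ))
    rw [ENNReal.ofReal_zero] at h2
    exact tendsto_of_tendsto_of_tendsto_of_le_of_le tendsto_const_nhds h2 (fun _ => zero_le)
      fun n => (hlt n).le
  have hi : Integrable (R.T (ofNorm Ω X)) μ := L1.integrable_coeFn _
  have h3 := hi.abs.tendsto_setIntegral_nhds_zero h1
  refine (isClosed_range_inclusionInDoubleDual X).mem_of_tendsto_norm_sub (fun n => ?_)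
    (fun n => R.norm_stdVectorMeasure_sub_le hw hn hE (hdense.measurable _ (ht n))) h3
  obtain ⟨A, hA, hAt⟩ := ht n
  rw [← hAt]
  exact hχ A hA

theorem pettisIntegrable_of_stdVectorMeasure_mem_range [OpensMeasurableSpace S] [IsFiniteMeasure μ]
    (R : AbstractStandardRepresentation m f μ)
    (hw : WeaklyIntegrable m f) (hn : NormIntegrable m f)
    (h : ∀ E : Set S, MeasurableSet E →
      R.stdVectorMeasure hw hn E ∈ range (NormedSpace.inclusionInDoubleDual ℝ X)) :
    PettisIntegrable m f := by
  intro A hA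
  obtain ⟨x, hx⟩ := h (R.χ A)
    (R.isClopen_χ A (mem_contentCompletion m hA)).isOpen.measurableSet
  refine ⟨x, fun x' => ?_⟩
  have h1 := R.stdVectorMeasure_χ hw hn hA x'
  rwa [← hx] at h1

theorem T₀adj_simpleFunc_mem_range [IsFiniteMeasure μ]
    (R : AbstractStandardRepresentation m f μ)
    (hw : WeaklyIntegrable m f) (hn : NormIntegrable m f)
    (h : ∀ E : Set S, MeasurableSet E →
      R.stdVectorMeasure hw hn E ∈ range (NormedSpace.inclusionInDoubleDual ℝ X))
    (u : SimpleFunc S ℝ) : R.T₀adj hw hn ((u.memLp_top μ).toLp u)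
      ∈ range (NormedSpace.inclusionInDoubleDual ℝ X) := by
  induction u using SimpleFunc.induction with
  | const c hE =>
    rename_i E
    obtain ⟨x, hx⟩ := h E hE
    rw [stdVectorMeasure_apply _ _ _ hE] at hx
    set u := SimpleFunc.piecewise E hE (SimpleFunc.const S c) (SimpleFunc.const S 0)
    have h1 : (u.memLp_top μ).toLp u = c • indicatorConstLp ∞ hE (measure_ne_top μ E) (1 : ℝ) := by
      ext1
      refine (MemLp.coeFn_toLp _).trans (EventuallyEq.trans ?_ (Lp.coeFn_smul _ _).symm)
      filter_upwards [indicatorConstLp_coeFn (p := ∞) (hs := hE) (hμs := measure_ne_top μ E)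
        (c := (1 : ℝ))] with s hs
      by_cases h4 : s ∈ E <;> simp [u, hs, h4]
    refine ⟨c • x, ?_⟩
    rw [h1]
    refine ((NormedSpace.inclusionInDoubleDual ℝ X).map_smul c x).trans ?_
    rw [hx]
    exact ((R.T₀adj hw hn).map_smul c _).symm
  | add _ hu hv =>
    rename_i u v _
    obtain ⟨x, hx⟩ := hu
    obtain ⟨y, hy⟩ := hv
    have h1 : ((u + v).memLp_top μ).toLp (u + v)
        = (u.memLp_top μ).toLp u + (v.memLp_top μ).toLp v :=
      MemLp.toLp_add (u.memLp_top μ) (v.memLp_top μ)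
    refine ⟨x + y, ?_⟩
    rw [h1]
    refine ((NormedSpace.inclusionInDoubleDual ℝ X).map_add x y).trans ?_
    rw [hx, hy]
    exact ((R.T₀adj hw hn).map_add _ _).symm

/-- Simple functions bounded by `‖b‖` converge to `b` a.e. By dominated convergence, with majorant
`2‖b‖ |T(‖·‖)|`, their images under `T₀*` converge in norm. -/
theorem T₀adj_mem_range_of_stdVectorMeasure_mem_range [CompleteSpace X] [IsFiniteMeasure μ]
    (R : AbstractStandardRepresentation m f μ)
    (hw : WeaklyIntegrable m f) (hn : NormIntegrable m f)
    (h : ∀ E : Set S, MeasurableSet E →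
      R.stdVectorMeasure hw hn E ∈ range (NormedSpace.inclusionInDoubleDual ℝ X))
    (b : Lp ℝ ∞ μ) : R.T₀adj hw hn b ∈ range (NormedSpace.inclusionInDoubleDual ℝ X) := by
  have hsimple := R.T₀adj_simpleFunc_mem_range hw hn h
  have hb : StronglyMeasurable b := Lp.stronglyMeasurable b
  have hbd : ∀ᵐ s ∂μ, ‖b s‖ ≤ ‖b‖ := by
    filter_upwards [ae_le_eLpNormEssSup (f := b) (μ := μ)] with s hs
    rw [Lp.norm_def, eLpNorm_exponent_top, ← toReal_enorm]
    refine ENNReal.toReal_mono ?_ hs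
    rw [← eLpNorm_exponent_top]
    exact Lp.eLpNorm_ne_top b
  have hi : Integrable (R.T (ofNorm Ω X)) μ := L1.integrable_coeFn _
  have hlim : Tendsto (fun n => ∫ s, |hb.approxBounded ‖b‖ n s - b s| * |R.T (ofNorm Ω X) s| ∂μ)
      atTop (𝓝 0) := by
    rw [← integral_zero S ℝ (μ := μ)]
    refine tendsto_integral_of_dominated_convergence
      (fun s => (2 * ‖b‖) * |R.T (ofNorm Ω X) s|) (fun n => ?_) (hi.abs.const_mul _) (fun n => ?_) ?_
    · exact (((SimpleFunc.stronglyMeasurable _).sub hb).norm.aestronglyMeasurable).mul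
        hi.abs.aestronglyMeasurable
    · filter_upwards [hbd] with s hs
      rw [norm_mul, Real.norm_eq_abs, abs_abs, Real.norm_eq_abs, abs_abs]
      gcongr
      have h1 := hb.norm_approxBounded_le (norm_nonneg b) n s
      rw [two_mul]
      exact (norm_sub_le _ _).trans (add_le_add h1 hs)
    · filter_upwards [hb.tendsto_approxBounded_ae hbd] with s hs
      have h1 := ((hs.sub_const (b s)).abs).mul_const |R.T (ofNorm Ω X) s|
      simpa using h1
  refine (isClosed_range_inclusionInDoubleDual X).mem_of_tendsto_norm_sub
    (fun n => hsimple (hb.approxBounded ‖b‖ n))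
    (fun n => (R.norm_T₀adj_sub_le hw hn _ _).trans_eq (integral_congr_ae ?_)) hlim
  filter_upwards [((hb.approxBounded ‖b‖ n).memLp_top μ).coeFn_toLp] with s h1
  rw [h1, abs_sub_comm]

end StandardVectorMeasure

end AbstractStandardRepresentation

/-! ### The equivalences. -/

theorem lemma5p3 {Ω : Type*} {𝒜 : Set (Set Ω)} (h𝒜 : IsSetAlgebra 𝒜)
    (m : AddContent ℝ≥0 𝒜) (hm : m Set.univ = 1)
    {X : Type*} [NormedAddCommGroup X] [NormedSpace ℝ X] [CompleteSpace X]
    (f : Ω → X) (hw : WeaklyIntegrable m f) (hn : NormIntegrable m f)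
    {S : Type*} [TopologicalSpace S] [CompactSpace S] [T2Space S]
    [MeasurableSpace S] [BorelSpace S]
    (μ : Measure S) [IsProbabilityMeasure μ] [μ.Regular]
    (R : AbstractStandardRepresentation m f μ) :
    [ PettisIntegrable m f,
      Set.range (R.T₀adj hw hn) ⊆ Set.range (NormedSpace.inclusionInDoubleDual ℝ X),
      ∀ E : Set S, MeasurableSet E →
        R.stdVectorMeasure hw hn E ∈ Set.range (NormedSpace.inclusionInDoubleDual ℝ X),
      Continuous (fun x' : WeakDual ℝ X =>
        toWeakSpace ℝ (Lp ℝ 1 μ) (R.T₀ hw hn (WeakDual.toStrongDual x'))),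
      @Continuous (WeakDual ℝ X) (WeakSpace ℝ (Lp ℝ 1 μ)) (boundedWeakStarTopology X) inferInstance
        (fun x' => toWeakSpace ℝ (Lp ℝ 1 μ) (R.T₀ hw hn (WeakDual.toStrongDual x'))) ].TFAE := by
  tfae_have 1 → 3 := fun h E hE =>
    R.stdVectorMeasure_mem_range_of_pettisIntegrable h𝒜 hw hn h hE
  tfae_have 3 → 1 := R.pettisIntegrable_of_stdVectorMeasure_mem_range hw hn
  tfae_have 3 → 2 := by
    rintro h _ ⟨b, rfl⟩
    exact R.T₀adj_mem_range_of_stdVectorMeasure_mem_range hw hn h b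
  tfae_have 2 → 3 := by
    intro h E hE
    rw [AbstractStandardRepresentation.stdVectorMeasure_apply _ _ _ hE]
    exact h ⟨_, rfl⟩
  tfae_have 2 → 4 := by
    intro h
    refine WeakBilin.continuous_of_continuous_eval _ fun l => ?_
    -- Weak continuity is tested on one functional `l` at a time, and `l ∘ T₀ = T₀*(b)` is
    -- evaluation at a vector `x`.
    obtain ⟨b, hb⟩ := exists_Lp_top_forall_eq_integral_mul l
    obtain ⟨x, hx⟩ := h ⟨b, rfl⟩
    refine (WeakDual.eval_continuous (𝕜 := ℝ) x).congr fun x' => ?_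
    have h1 : x' x = R.T₀adj hw hn b (WeakDual.toStrongDual x') := by rw [← hx]; rfl
    rw [h1, AbstractStandardRepresentation.T₀adj_apply, ← hb]
    rfl
  tfae_have 4 → 5 := by
    intro h
    refine continuous_iSup_dom.2 fun r => continuous_coinduced_dom.2 ?_
    exact h.comp continuous_subtype_val
  tfae_have 5 → 2 := by
    rintro h _ ⟨b, rfl⟩
    refine mem_range_inclusionInDoubleDual_of_continuous_ball _ ?_
    -- Only the unit ball, `r = 1`, is needed. Pairing with `b` is weakly continuous on `L¹(μ)`, and
    -- its composition with `T₀` is `T₀*(b)`.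
    have h1 := continuous_coinduced_dom.1 (continuous_iSup_dom.1 h 1)
    let l : StrongDual ℝ (Lp ℝ 1 μ) := (ContinuousLinearMap.mul ℝ ℝ).lpPairing μ ∞ 1 b
    exact (WeakBilin.eval_continuous (topDualPairing ℝ (Lp ℝ 1 μ)).flip l).comp h1
  tfae_finish
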